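/- Let $X$ and $Y$ be topological spaces, let $\Lambda$ be a real Hausdorff topological vector space, and let $y_0\in Y$. Let $\varphi:Y\to[0,+\infty[$ be a lower semicontinuous function with $\varphi^{-1}(0)=\{y_0\}$ such that $\inf_{Y\setminus V}\varphi>0$ for each neighbourhood $V$ of $y_0$ (with the convention $\inf\emptyset=+\infty$). Let $\Psi:X\times\Lambda\to Y$ be such that, for each $x\in X$, the function $\Psi(x,\cdot)$ is continuous, injective and open and takes the value $y_0$ at a (necessarily unique) point $\lambda_x\in\Lambda$, and such that the function $x\mapsto\lambda_x$ is not constant. Let $J:X\to\mathbf R$ be a function whose set $M_J$ of global minima is non-empty, and put $$\theta(\varphi,\Psi,J)=\inf\left\{\frac{J(x)-J(u)}{\varphi(\Psi(x,\lambda_u))} : (u,x)\in M_J\times X,\ \lambda_x\neq\lambda_u\right\}.$$ Assume that $\varphi(\Psi(x,\cdot))$ is convex on $\Lambda$ for each $x\in X$, and let $\mu>\theta(\varphi,\Psi,J)$ be a real number. Let $\mathcal N$ be a filtering cover of $X$, that is, a family of non-empty subsets of $X$ whose union is $X$ and such that for all $A_1,A_2\in\mathcal N$ there is $A_3\in\mathcal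 N$ with $A_1\cup A_2\subseteq A_3$. Assume that, for each $A\in\mathcal N$ and each $\lambda\in\operatorname{conv}(\{\lambda_x : x\in X\})$, the restriction to $A$ of the function $x\mapsto J(x)-\mu\varphi(\Psi(x,\lambda))$ is lower semicontinuous and inf-compact, i.e. its sublevel sets $\{x\in A : J(x)-\mu\varphi(\Psi(x,\lambda))\le r\}$, $r\in\mathbf R$, are compact. Then there exist $A\in\mathcal N$ and $\lambda^*\in\operatorname{conv}(\{\lambda_x : x\in A\})$ such that the restriction of the function $x\mapsto J(x)-\mu\varphi(\Psi(x,\lambda^*))$ to $A$ has at least two global minima. -/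

import Mathlib

open Set Topology

/-- A filtering cover of `X`: a family of non-empty subsets covering `X` and upward directed in the
sense that the union of any two members is contained in a member. -/
structure IsFilteringCover {X : Type*} (𝒩 : Set (Set X)) : Prop where
  nonempty_of_mem : ∀ A ∈ 𝒩, A.Nonempty
  sUnion_eq : ⋃₀ 𝒩 = univ
  directed : ∀ A₁ ∈ 𝒩, ∀ A₂ ∈ 𝒩, ∃ A₃ ∈ 𝒩, A₁ ∪ A₂ ⊆ A₃

/-- A real function on a topological space is inf-compact if all its sublevel sets are compact. -/
def InfCompact {U : Type*} [TopologicalSpace U] (ψ : U → ℝ) : Prop :=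
  ∀ r : ℝ, IsCompact {x : U | ψ x ≤ r}

/-- The class `𝒢` of lower semicontinuous functions `φ : Y → [0, +∞[` vanishing exactly at `y₀`
and whose infimum outside each neighbourhood of `y₀` is positive (with `inf ∅ = +∞`). -/
structure MemClassG {Y : Type*} [TopologicalSpace Y] (y₀ : Y) (φ : Y → ℝ) : Prop where
  lsc : LowerSemicontinuous φ
  nonneg : ∀ y, 0 ≤ φ y
  eq_zero_iff : ∀ y, φ y = 0 ↔ y = y₀
  pos_off_nhds : ∀ V ∈ 𝓝 y₀, ∃ c : ℝ, 0 < c ∧ ∀ y ∉ V, c ≤ φ y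

/-- The class `ℋ` of functions `Ψ : X × Λ → Y` (curried) such that each `Ψ(x, ·)` is continuous,
injective, open and takes the value `y₀` at a (unique) point, and such that this point is not the
same for all `x`. -/
structure MemClassH {X Λ Y : Type*} [TopologicalSpace Λ] [TopologicalSpace Y] (y₀ : Y)
    (Ψ : X → Λ → Y) : Prop where
  continuous : ∀ x, Continuous (Ψ x)
  injective : ∀ x, Function.Injective (Ψ x)
  isOpenMap : ∀ x, IsOpenMap (Ψ x)
  exists_eq : ∀ x, ∃ l : Λ, Ψ x l = y₀
  not_constant : ∃ (x₁ x₂ : X) (l₁ l₂ : Λ), Ψ x₁ l₁ = y₀ ∧ Ψ x₂ l₂ = y₀ ∧ l₁ ≠ l₂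

/-- The point `λ_x`, that is, the unique `l : Λ` with `Ψ(x, l) = y₀`. -/
noncomputable def MemClassH.pt {X Λ Y : Type*} [TopologicalSpace Λ] [TopologicalSpace Y] {y₀ : Y}
    {Ψ : X → Λ → Y} (hΨ : MemClassH y₀ Ψ) (x : X) : Λ :=
  (hΨ.exists_eq x).choose

theorem MemClassH.apply_eq_iff {X Λ Y : Type*} [TopologicalSpace Λ] [TopologicalSpace Y] {y₀ : Y}
    {Ψ : X → Λ → Y} (hΨ : MemClassH y₀ Ψ) (x : X) (l : Λ) : Ψ x l = y₀ ↔ l = hΨ.pt x := by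
  have h : Ψ x (hΨ.pt x) = y₀ := (hΨ.exists_eq x).choose_spec
  constructor
  · intro hl
    exact hΨ.injective x (hl.trans h.symm)
  · rintro rfl
    exact h

/-- The set `M_J` of all global minima of `J`. -/
def globalMinima {X : Type*} (J : X → ℝ) : Set X :=
  {u | ∀ x, J u ≤ J x}

/-- The set of quotients whose infimum is `θ(φ, Ψ, J)`. -/
def thetaSet {X Λ Y : Type*} [TopologicalSpace Λ] [TopologicalSpace Y] {y₀ : Y}
    (φ : Y → ℝ) {Ψ : X → Λ → Y} (hΨ : MemClassH y₀ Ψ) (J : X → ℝ) : Set ℝ :=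
  {t | ∃ u ∈ globalMinima J, ∃ x : X,
    hΨ.pt x ≠ hΨ.pt u ∧ t = (J x - J u) / φ (Ψ x (hΨ.pt u))}

theorem thetaSet_nonempty {X Λ Y : Type*} [TopologicalSpace Λ] [TopologicalSpace Y] {y₀ : Y}
    (φ : Y → ℝ) {Ψ : X → Λ → Y} (hΨ : MemClassH y₀ Ψ) {J : X → ℝ}
    (hJ : (globalMinima J).Nonempty) : (thetaSet φ hΨ J).Nonempty := by
  obtain ⟨u, hu⟩ := hJ
  obtain ⟨x₁, x₂, l₁, l₂, h₁, h₂, hne⟩ := hΨ.not_constant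
  rw [hΨ.apply_eq_iff] at h₁ h₂
  subst h₁ h₂
  by_cases h : hΨ.pt x₁ = hΨ.pt u
  · exact ⟨_, u, hu, x₂, fun h' => hne (h.trans h'.symm), rfl⟩
  · exact ⟨_, u, hu, x₁, h, rfl⟩

theorem thetaSet_bddBelow {X Λ Y : Type*} [TopologicalSpace Λ] [TopologicalSpace Y] {y₀ : Y}
    {φ : Y → ℝ} (hφ : MemClassG y₀ φ) {Ψ : X → Λ → Y} (hΨ : MemClassH y₀ Ψ) (J : X → ℝ) :
    BddBelow (thetaSet φ hΨ J) := by
  refine ⟨0, ?_⟩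
  rintro t ⟨u, hu, x, -, rfl⟩
  exact div_nonneg (sub_nonneg.2 (hu x)) (hφ.nonneg _)

/-- The number `θ(φ, Ψ, J)`. For `φ ∈ 𝒢`, `Ψ ∈ ℋ` and `J` with a global minimum this is the infimum
of a non-empty set of reals bounded below by `0`, all the denominators being positive. -/
noncomputable def theta {X Λ Y : Type*} [TopologicalSpace Λ] [TopologicalSpace Y] {y₀ : Y}
    (φ : Y → ℝ) {Ψ : X → Λ → Y} (hΨ : MemClassH y₀ Ψ) (J : X → ℝ) : ℝ :=
  sInf (thetaSet φ hΨ J)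

/-! Put `f x l = J x - μ * φ (Ψ x l)`, concave and usc in `l`. Since `μ` exceeds `theta`, two points
`u`, `v` keep `inf_x f x l` below some `r < min J` for all `l` (`exists_pair_lt_of_theta_lt`). Pick
`A ∈ 𝒩` containing both. If every `f · l` had a unique minimum on `A`, a minimax principle
(`exists_forall_le_of_unique_min`) would give one `x` with `f x l ≤ r` for all `l` in the hull; but
`f x (hΨ.pt x) = J x ≥ min J`. Uniqueness replaces the usual quasiconvexity in `x`. -/

/-- A lower semicontinuous inf-compact function on a non-empty space attains its minimum. -/
theorem InfCompact.exists_forall_le {Z : Type*} [TopologicalSpace Z] [Nonempty Z] {ψ : Z → ℝ}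
    (hc : InfCompact ψ) (hl : LowerSemicontinuous ψ) : ∃ x, ∀ z, ψ x ≤ ψ z := by
  obtain ⟨z₀⟩ := ‹Nonempty Z›
  obtain ⟨x, hx, hmin⟩ := LowerSemicontinuousOn.exists_isMinOn (s := {z | ψ z ≤ ψ z₀})
    ⟨z₀, le_refl (ψ z₀)⟩ (hc _) (hl.lowerSemicontinuousOn _)
  refine ⟨x, fun z => ?_⟩
  by_cases hz : ψ z ≤ ψ z₀
  · exact hmin hz
  · exact le_trans hx (not_le.1 hz).le

/-- A function which is lower semicontinuous and inf-compact in the first variable, concave and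
upper semicontinuous in the second one, and whose partial functions in the first variable have a
unique global minimum, has a saddle point when the second variable ranges over a compact set. -/
theorem exists_saddle_of_unique_min {Z Λ : Type*} [TopologicalSpace Z] [Nonempty Z]
    [AddCommGroup Λ] [Module ℝ Λ] [TopologicalSpace Λ] {S : Set Λ} (hS : IsCompact S)
    (hne : S.Nonempty) {f : Z → Λ → ℝ}
    (hlsc : ∀ l ∈ S, LowerSemicontinuous (fun x => f x l))
    (hcomp : ∀ l ∈ S, InfCompact (fun x => f x l))
    (hconc : ∀ x, ConcaveOn ℝ S (f x)) (husc : ∀ x, UpperSemicontinuousOn (f x) S)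
    (huniq : ∀ l ∈ S, ∀ x₁ x₂, (∀ z, f x₁ l ≤ f z l) → (∀ z, f x₂ l ≤ f z l) → x₁ = x₂) :
    ∃ l ∈ S, ∃ x, (∀ z, f x l ≤ f z l) ∧ ∀ m ∈ S, f x m ≤ f x l := by
  have hex : ∀ l, ∃ x, l ∈ S → ∀ z, f x l ≤ f z l := by
    intro l
    by_cases hl : l ∈ S
    · obtain ⟨x, hx⟩ := (hcomp l hl).exists_forall_le (hlsc l hl)
      exact ⟨x, fun _ => hx⟩
    · exact ⟨Classical.arbitrary Z, fun h => (hl h).elim⟩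
  choose a ha using hex
  -- The lower envelope `inf_x f x l` is usc, as an infimum of usc functions.
  have hg : UpperSemicontinuousOn (fun l => f (a l) l) S := by
    intro l hl c hc
    filter_upwards [husc (a l) l hl c hc, self_mem_nhdsWithin] with m hm hmS
    exact (ha m hmS _).trans_lt hm
  obtain ⟨l, hl, hmax⟩ := UpperSemicontinuousOn.exists_isMaxOn hne hS hg
  refine ⟨l, hl, a l, ha l hl, fun m hm => ?_⟩
  set G := f (a l) l with hG
  -- Move from the maximiser `l` a little towards `m`: the minimiser at the new point is at most `G`
  -- at `m` and, by concavity, almost minimal at `l`.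
  have key : ∀ t : ℝ, 0 < t → t < 1 →
      ∃ x, f x m ≤ G ∧ (1 - t) * f x l ≤ G - t * f (a m) m := by
    intro t ht0 ht1
    have hp : (1 - t) • l + t • m ∈ S :=
      (hconc (a l)).1 hl hm (by linarith) ht0.le (by ring)
    set p := (1 - t) • l + t • m
    have h1 : (1 - t) * f (a p) l + t * f (a p) m ≤ f (a p) p := by
      simpa using (hconc (a p)).2 hl hm (by linarith) ht0.le (by ring)
    have h2 : f (a p) p ≤ G := hmax hp
    have h3 : (1 - t) * G ≤ (1 - t) * f (a p) l :=
      mul_le_mul_of_nonneg_left (ha l hl _) (by linarith)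
    have h4 : t * f (a m) m ≤ t * f (a p) m := mul_le_mul_of_nonneg_left (ha m hm _) ht0.le
    exact ⟨a p, le_of_mul_le_mul_left (by linarith) ht0, by linarith⟩
  obtain ⟨z, hz, -⟩ := key (1 / 2) (by norm_num) (by norm_num)
  -- This `x` does not depend on `t`, so no cluster point of minimisers is needed as `t → 0`.
  obtain ⟨x, hx, hxmin⟩ := LowerSemicontinuousOn.exists_isMinOn (s := {z | f z m ≤ G})
    ⟨z, hz⟩ (hcomp m hm G) ((hlsc l hl).lowerSemicontinuousOn _)
  have hbound : ∀ t : ℝ, 0 < t → t < 1 → (1 - t) * f x l ≤ G - t * f (a m) m := by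
    intro t ht0 ht1
    obtain ⟨w, hw, hwt⟩ := key t ht0 ht1
    exact (mul_le_mul_of_nonneg_left (hxmin hw) (by linarith)).trans hwt
  have hlim : (1 - 0) * f x l ≤ G - 0 * f (a m) m := by
    refine le_of_tendsto_of_tendsto (b := 𝓝[>] (0 : ℝ))
      (f := fun t => (1 - t) * f x l) (g := fun t => G - t * f (a m) m) ?_ ?_ ?_
    · exact (Continuous.tendsto (by fun_prop) 0).mono_left nhdsWithin_le_nhds
    · exact (Continuous.tendsto (by fun_prop) 0).mono_left nhdsWithin_le_nhds
    · filter_upwards [Ioo_mem_nhdsGT (zero_lt_one' ℝ)] with t ht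
      exact hbound t ht.1 ht.2
  have hxa : x = a l := huniq l hl _ _
    (fun z => (by simpa using hlim : f x l ≤ G).trans (ha l hl z)) (ha l hl)
  exact hxa ▸ hx

/-- Under the assumptions of `exists_saddle_of_unique_min` except for compactness, any upper bound
of the sup-inf over a convex set is a bound of the function along some horizontal line. -/
theorem exists_forall_le_of_unique_min {Z Λ : Type*} [TopologicalSpace Z] [Nonempty Z]
    [AddCommGroup Λ] [Module ℝ Λ] [TopologicalSpace Λ] [IsTopologicalAddGroup Λ]
    [ContinuousSMul ℝ Λ] {C : Set Λ} (hne : C.Nonempty) {f : Z → Λ → ℝ}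
    (hlsc : ∀ l ∈ C, LowerSemicontinuous (fun x => f x l))
    (hcomp : ∀ l ∈ C, InfCompact (fun x => f x l))
    (hC : Convex ℝ C)
    (hconc : ∀ x, ConcaveOn ℝ C (f x)) (husc : ∀ x, UpperSemicontinuousOn (f x) C)
    (huniq : ∀ l ∈ C, ∀ x₁ x₂, (∀ z, f x₁ l ≤ f z l) → (∀ z, f x₂ l ≤ f z l) → x₁ = x₂)
    {r : ℝ} (hr : ∀ l ∈ C, ∃ x, f x l ≤ r) : ∃ x, ∀ l ∈ C, f x l ≤ r := by
  classical
  obtain ⟨l₀, hl₀⟩ := hne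
  -- Finite intersection property inside the compact sublevel set at `l₀`; each finite case is a
  -- saddle point over a compact hull.
  have hfip : ({x | f x l₀ ≤ r} ∩ ⋂ l : C, {x | f x l ≤ r}).Nonempty := by
    refine (hcomp l₀ hl₀ r).inter_iInter_nonempty _
      (fun l => (hlsc l l.2).isClosed_preimage r) fun u => ?_
    set F : Set Λ := insert l₀ ((↑) '' (u : Set C)) with hF
    have hFC : F ⊆ C := insert_subset hl₀ (by rintro _ ⟨l, -, rfl⟩; exact l.2)
    have hSC : convexHull ℝ F ⊆ C := convexHull_min hFC hC
    obtain ⟨l, hl, x, hx, hxm⟩ := exists_saddle_of_unique_min (S := convexHull ℝ F) (f := f)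
      (Set.Finite.isCompact_convexHull ℝ ((u.finite_toSet.image _).insert _))
      ⟨l₀, subset_convexHull ℝ F (mem_insert _ _)⟩
      (fun l hl => hlsc l (hSC hl)) (fun l hl => hcomp l (hSC hl))
      (fun x => (hconc x).subset hSC (convex_convexHull ℝ F)) (fun x => (husc x).mono hSC)
      (fun l hl => huniq l (hSC hl))
    obtain ⟨z, hz⟩ := hr l (hSC hl)
    have hle : ∀ m ∈ F, f x m ≤ r := fun m hm =>
      (hxm m (subset_convexHull ℝ F hm)).trans ((hx z).trans hz)
    refine ⟨x, hle l₀ (mem_insert _ _), ?_⟩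
    simp only [mem_iInter]
    exact fun m hm => hle m (mem_insert_of_mem _ ⟨m, hm, rfl⟩)
  obtain ⟨x, -, hx⟩ := hfip
  exact ⟨x, fun l hl => mem_iInter.1 hx ⟨l, hl⟩⟩

theorem MemClassH.apply_pt {X Λ Y : Type*} [TopologicalSpace Λ] [TopologicalSpace Y] {y₀ : Y}
    {Ψ : X → Λ → Y} (hΨ : MemClassH y₀ Ψ) (x : X) : Ψ x (hΨ.pt x) = y₀ :=
  (hΨ.apply_eq_iff x _).2 rfl

theorem theta_nonneg {X Λ Y : Type*} [TopologicalSpace Λ] [TopologicalSpace Y] {y₀ : Y}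
    {φ : Y → ℝ} (hφ : MemClassG y₀ φ) {Ψ : X → Λ → Y} (hΨ : MemClassH y₀ Ψ) (J : X → ℝ) :
    0 ≤ theta φ hΨ J := by
  refine Real.sInf_nonneg ?_
  rintro t ⟨u, hu, x, -, rfl⟩
  exact div_nonneg (sub_nonneg.2 (hu x)) (hφ.nonneg _)

theorem MemClassG.upperSemicontinuous_sub {X Λ Y : Type*} [TopologicalSpace Λ]
    [TopologicalSpace Y] {y₀ : Y} {φ : Y → ℝ} (hφ : MemClassG y₀ φ) {Ψ : X → Λ → Y}
    (hΨ : MemClassH y₀ Ψ) (J : X → ℝ) {μ : ℝ} (hμ : 0 < μ) (x : X) :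
    UpperSemicontinuous (fun l => J x - μ * φ (Ψ x l)) := by
  intro l c hc
  have h : (J x - c) / μ < φ (Ψ x l) := by
    rw [div_lt_iff₀ hμ]; linarith
  filter_upwards [(hΨ.continuous x).continuousAt.eventually (hφ.lsc _ _ h)] with m hm
  rw [gt_iff_lt, div_lt_iff₀ hμ] at hm
  linarith

/-- If `μ > θ(φ, Ψ, J)`, two points suffice to keep the lower envelope of the functions
`l ↦ J x - μ φ(Ψ(x, l))` uniformly below the minimum of `J`. -/
theorem exists_pair_lt_of_theta_lt {X Λ Y : Type*} [TopologicalSpace Λ] [TopologicalSpace Y]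
    {y₀ : Y} {φ : Y → ℝ} (hφ : MemClassG y₀ φ) {Ψ : X → Λ → Y} (hΨ : MemClassH y₀ Ψ)
    {J : X → ℝ} (hJ : (globalMinima J).Nonempty) {μ : ℝ} (hμ : theta φ hΨ J < μ) :
    ∃ u ∈ globalMinima J, ∃ v, ∃ r < J u,
      ∀ l, J u - μ * φ (Ψ u l) ≤ r ∨ J v - μ * φ (Ψ v l) ≤ r := by
  have hμ0 : 0 < μ := (theta_nonneg hφ hΨ J).trans_lt hμ
  obtain ⟨_, ⟨u, hu, v, hne, rfl⟩, hlt⟩ := exists_lt_of_csInf_lt (thetaSet_nonempty φ hΨ hJ) hμ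
  have hpos : 0 < φ (Ψ v (hΨ.pt u)) :=
    (hφ.nonneg _).lt_of_ne' fun h =>
      hne ((hΨ.apply_eq_iff v _).1 ((hφ.eq_zero_iff _).1 h)).symm
  rw [div_lt_iff₀ hpos] at hlt
  obtain ⟨s, hs, hsu⟩ := exists_between (show J v - μ * φ (Ψ v (hΨ.pt u)) < J u by linarith)
  -- Near `hΨ.pt u` the point `v` gives values below `s`; elsewhere `Ψ u l` stays away from `y₀`,
  -- because `Ψ u` is open and injective, so `φ (Ψ u l) ≥ c`.
  have hW := hφ.upperSemicontinuous_sub hΨ J hμ0 v (hΨ.pt u) s hs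
  have hV := (hΨ.isOpenMap u).image_mem_nhds hW
  rw [hΨ.apply_pt] at hV
  obtain ⟨c, hc, hcV⟩ := hφ.pos_off_nhds _ hV
  refine ⟨u, hu, v, max s (J u - μ * c), max_lt hsu (by nlinarith [mul_pos hμ0 hc]), fun l => ?_⟩
  by_cases hl : J v - μ * φ (Ψ v l) < s
  · exact Or.inr (hl.le.trans (le_max_left _ _))
  · refine Or.inl (le_trans ?_ (le_max_right _ _))
    have := mul_le_mul_of_nonneg_left (hcV (Ψ u l) ?_) hμ0.le
    · linarith
    · rintro ⟨m, hm, hml⟩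
      exact hl (hΨ.injective u hml ▸ hm)

theorem theorem3p3 {X Λ Y : Type*} [TopologicalSpace X] [AddCommGroup Λ] [Module ℝ Λ]
    [TopologicalSpace Λ] [IsTopologicalAddGroup Λ] [ContinuousSMul ℝ Λ] [T2Space Λ]
    [TopologicalSpace Y] (y₀ : Y) (φ : Y → ℝ) (hφ : MemClassG y₀ φ)
    (Ψ : X → Λ → Y) (hΨ : MemClassH y₀ Ψ)
    (J : X → ℝ) (hJ : (globalMinima J).Nonempty)
    (hconv : ∀ x, ConvexOn ℝ univ (fun l => φ (Ψ x l)))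
    (μ : ℝ) (hμ : theta φ hΨ J < μ)
    (𝒩 : Set (Set X)) (h𝒩 : IsFilteringCover 𝒩)
    (hlsc : ∀ A ∈ 𝒩, ∀ l ∈ convexHull ℝ (range hΨ.pt),
      LowerSemicontinuous (fun x : A => J x - μ * φ (Ψ x l)) ∧
        InfCompact (fun x : A => J x - μ * φ (Ψ x l))) :
    ∃ A ∈ 𝒩, ∃ l ∈ convexHull ℝ (hΨ.pt '' A), ∃ x₁ ∈ A, ∃ x₂ ∈ A, x₁ ≠ x₂ ∧
      IsMinOn (fun x => J x - μ * φ (Ψ x l)) A x₁ ∧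
      IsMinOn (fun x => J x - μ * φ (Ψ x l)) A x₂ := by
  have hμ0 : 0 < μ := (theta_nonneg hφ hΨ J).trans_lt hμ
  obtain ⟨u, hu, v, r, hr, hbd⟩ := exists_pair_lt_of_theta_lt hφ hΨ hJ hμ
  have hcover : ∀ x : X, ∃ A ∈ 𝒩, x ∈ A := fun x =>
    mem_sUnion.1 (h𝒩.sUnion_eq ▸ mem_univ x)
  obtain ⟨A₁, hA₁, huA⟩ := hcover u
  obtain ⟨A₂, hA₂, hvA⟩ := hcover v
  obtain ⟨A, hA, hsub⟩ := h𝒩.directed A₁ hA₁ A₂ hA₂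
  have hu' : u ∈ A := hsub (Or.inl huA)
  have hv' : v ∈ A := hsub (Or.inr hvA)
  by_contra hcon
  push Not at hcon
  have hCsub : convexHull ℝ (hΨ.pt '' A) ⊆ convexHull ℝ (range hΨ.pt) :=
    convexHull_mono (image_subset_range _ _)
  have hpt : ∀ x ∈ A, hΨ.pt x ∈ convexHull ℝ (hΨ.pt '' A) := fun x hx =>
    subset_convexHull ℝ _ (mem_image_of_mem _ hx)
  have : Nonempty A := ⟨⟨u, hu'⟩⟩
  obtain ⟨x, hx⟩ := exists_forall_le_of_unique_min (Z := A) (C := convexHull ℝ (hΨ.pt '' A))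
    (f := fun x l => J x - μ * φ (Ψ x l)) ⟨_, hpt u hu'⟩
    (fun l hl => (hlsc A hA l (hCsub hl)).1) (fun l hl => (hlsc A hA l (hCsub hl)).2)
    (convex_convexHull ℝ _)
    (fun x => ((concaveOn_const (J x) convex_univ).sub ((hconv x).smul hμ0.le)).subset
      (subset_univ _) (convex_convexHull ℝ _))
    (fun x => (hφ.upperSemicontinuous_sub hΨ J hμ0 x).upperSemicontinuousOn _)
    (fun l hl x₁ x₂ h₁ h₂ => by
      by_contra hne
      exact hcon A hA l hl x₁ x₁.2 x₂ x₂.2 (fun h => hne (Subtype.ext h))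
        (fun z hz => h₁ ⟨z, hz⟩) (fun z hz => h₂ ⟨z, hz⟩))
    (r := r) (fun l _ => (hbd l).elim (fun h => ⟨⟨u, hu'⟩, h⟩) fun h => ⟨⟨v, hv'⟩, h⟩)
  -- At `l = hΨ.pt x` the penalty vanishes, leaving `J x ≤ r < J u`.
  have h := hx (hΨ.pt x) (hpt x x.2)
  simp only [hΨ.apply_pt, (hφ.eq_zero_iff y₀).2 rfl, mul_zero, sub_zero] at h
  exact absurd (hu x) (not_le.2 (h.trans_lt hr))
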